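/- Let $d\in\mathbb N$, let $O\in\mathbb R^{d\times d}$ be an orthogonal matrix, and call $\mathbf b,\mathbf b^*\in\{0,1\}^d$ of \emph{high overlap} if $\|O(\mathbf b-\mathbf b^*)\|_1\le d/4$. Consider quantum query algorithms (of arbitrary finite workspace dimension, which may depend on $d$ and $O$) that access an unknown bit string $\mathbf b\in\{0,1\}^d$ only through calls to the controlled phase oracle \[ |0\rangle|j\rangle\mapsto|0\rangle|j\rangle,\qquad |1\rangle|j\rangle\mapsto(-1)^{b_j}|1\rangle|j\rangle\qquad(1\le j\le d): \] the algorithm starts in a fixed basis state, alternates unitaries that do not depend on $\mathbf b$ with oracle calls, and finally measures and outputs a bit string $\mathbf b^*\in\{0,1\}^d$. Suppose such an algorithm, for every $\mathbf b\in\{0,1\}^d$, outputs with probability at least $2/3$ a bit string $\mathbf b^*$ with $\|O(\mathbf b-\mathbf b^*)\|_1\le d/4$. Then the number of oracle calls it makes is $\Omega(d)$ as $d\to\infty$, with an implied constant that does not depend on $O$ or on the algorithm; in fact, for all $d\ge 250$ it makes at least $d/3000$ calls. -/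

import Mathlib

open scoped Matrix

/-- The real vector in `{0,1}^d` given by a bit string. -/
def bitVec {d : ℕ} (b : Fin d → Bool) : Fin d → ℝ :=
  fun j => if b j then 1 else 0

/-- `b` and `b'` have high overlap with respect to `O`: the `ℓ₁`-norm of `O (b - b')` is at most
`d / 4`. -/
def HighOverlap {d : ℕ} (O : Matrix (Fin d) (Fin d) ℝ) (b b' : Fin d → Bool) : Prop :=
  ∑ i, |(O *ᵥ (bitVec b - bitVec b')) i| ≤ (d : ℝ) / 4

/-- Computational basis states `|c⟩|j⟩|w⟩`: a control qubit, the index register of the oracle and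
a workspace of dimension `m`. -/
abbrev QueryBasis (d m : ℕ) : Type := Bool × Fin d × Fin m

/-- The controlled phase oracle
`|0⟩|j⟩|w⟩ ↦ |0⟩|j⟩|w⟩`, `|1⟩|j⟩|w⟩ ↦ (-1)^{b_j} |1⟩|j⟩|w⟩`.
(The uncontrolled oracle is its restriction to control state `|1⟩`.) -/
def controlledPhaseOracle {d : ℕ} (m : ℕ) (b : Fin d → Bool) :
    Matrix (QueryBasis d m) (QueryBasis d m) ℂ :=
  Matrix.diagonal fun x => if x.1 then (-1 : ℂ) ^ (b x.2.1).toNat else 1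

/-- A bounded-query quantum algorithm with access to a bit string of length `d` through the
controlled phase oracle: it starts in a computational basis state, alternates input-independent
unitaries `U 0, U 1, …, U queries` with `queries` oracle calls, measures in the computational
basis, and outputs a bit string computed from the measurement outcome.
Ancillas, internal randomness and intermediate measurements are covered by the workspace, whose
finite dimension is arbitrary.  The unitaries `U t` with `t > queries` are never used. -/
structure QueryAlgorithm (d : ℕ) where
  /-- dimension of the workspace -/
  workDim : ℕ
  /-- number of calls to the oracle -/
  queries : ℕ
  /-- initial basis state -/
  start : QueryBasis d workDim
  /-- the unitaries between the oracle calls -/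
  U : ℕ → Matrix.unitaryGroup (QueryBasis d workDim) ℂ
  /-- classical post-processing of the measurement outcome -/
  output : QueryBasis d workDim → (Fin d → Bool)

namespace QueryAlgorithm

/-- The state `U t O^{(b)} U (t-1) ⋯ O^{(b)} U 0 |start⟩` after `t` calls to the oracle. -/
def state {d : ℕ} (A : QueryAlgorithm d) (b : Fin d → Bool) : ℕ → QueryBasis d A.workDim → ℂ
  | 0 => (A.U 0).1 *ᵥ Pi.single A.start 1
  | t + 1 => (A.U (t + 1)).1 *ᵥ (controlledPhaseOracle A.workDim b *ᵥ A.state b t)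

open Classical in
/-- The probability that, on input `b`, the output bit string satisfies `P` (Born rule). -/
noncomputable def outputProb {d : ℕ} (A : QueryAlgorithm d) (b : Fin d → Bool)
    (P : (Fin d → Bool) → Prop) : ℝ :=
  ∑ x with P (A.output x), ‖A.state b A.queries x‖ ^ 2

/-- On every input `b`, the algorithm outputs, with probability at least `2/3`, a bit string that
has high overlap with `b`. -/
def ProducesHighOverlap {d : ℕ} (A : QueryAlgorithm d) (O : Matrix (Fin d) (Fin d) ℝ) : Prop :=
  ∀ b : Fin d → Bool, 2 / 3 ≤ A.outputProb b (fun b' => HighOverlap O b b')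

end QueryAlgorithm

/-! The polynomial method is played against exponentially small success by guessing. After `T`
queries each amplitude is a polynomial of degree at most `T` in the signs `(-1)^{b_j}`. Such a
polynomial has squared modulus at most `D` times its mean square, where `D` counts the Walsh
functions of degree at most `T`. Hence the average success probability is at most `D * ε`, where `ε`
bounds the fraction of inputs having high overlap with any one fixed output
(`cubeAvg_outputProb_le`).

For `ε`, `F(b) = ‖O(b - b')‖₁` has mean at least `0.353 d`: every row of `O` is a unit vector, so
sharp Khintchine applies to it. Moreover `F` is convex with subgradients of squared norm `d`, and a
Talagrand-type transport inequality (`exists_convex_transport`) gives a Gaussian lower tail. Since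
`1/4 < 0.353`, `ε` is exponentially small in `d` (`cubeAvg_highOverlap_le`). If `T < d / 3000`, then
`D` grows too slowly to compensate. -/

/-! ### Averages and Walsh analysis on the cube -/

/-- The average of a real function over the Boolean cube. -/
noncomputable def cubeAvg {n : ℕ} (f : (Fin n → Bool) → ℝ) : ℝ :=
  (∑ b, f b) / 2 ^ n

theorem cubeAvg_add {n : ℕ} (f g : (Fin n → Bool) → ℝ) :
    cubeAvg (fun b => f b + g b) = cubeAvg f + cubeAvg g := by
  simp [cubeAvg, Finset.sum_add_distrib, add_div]

theorem cubeAvg_const_mul {n : ℕ} (c : ℝ) (f : (Fin n → Bool) → ℝ) :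
    cubeAvg (fun b => c * f b) = c * cubeAvg f := by
  simp [cubeAvg, ← Finset.mul_sum, mul_div_assoc]

theorem cubeAvg_const {n : ℕ} (c : ℝ) : cubeAvg (fun _ : Fin n → Bool => c) = c := by
  simp [cubeAvg]

theorem cubeAvg_sum {n : ℕ} {ι : Type*} (s : Finset ι) (f : ι → (Fin n → Bool) → ℝ) :
    cubeAvg (fun b => ∑ i ∈ s, f i b) = ∑ i ∈ s, cubeAvg (f i) := by
  simp only [cubeAvg]
  rw [Finset.sum_comm, Finset.sum_div]

theorem cubeAvg_mono {n : ℕ} {f g : (Fin n → Bool) → ℝ} (h : ∀ b, f b ≤ g b) :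
    cubeAvg f ≤ cubeAvg g := by
  unfold cubeAvg
  gcongr with b
  exact h b

theorem cubeAvg_comp_equiv {n : ℕ} (e : (Fin n → Bool) ≃ (Fin n → Bool))
    (f : (Fin n → Bool) → ℝ) : cubeAvg (fun b => f (e b)) = cubeAvg f := by
  unfold cubeAvg
  rw [Equiv.sum_comp e f]

/-- The sign `(-1)^b`. -/
def boolSign (b : Bool) : ℝ := if b then -1 else 1

theorem boolSign_not (b : Bool) : boolSign (!b) = -boolSign b := by
  cases b <;> simp [boolSign]

theorem boolSign_mul_self (b : Bool) : boolSign b * boolSign b = 1 := by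
  cases b <;> simp [boolSign]

/-- The Walsh function `χ_S(b) = ∏_{j ∈ S} (-1)^{b_j}`. -/
def walsh {n : ℕ} (S : Finset (Fin n)) (b : Fin n → Bool) : ℝ :=
  ∏ j ∈ S, boolSign (b j)

theorem walsh_mul_self {n : ℕ} (S : Finset (Fin n)) (b : Fin n → Bool) :
    walsh S b * walsh S b = 1 := by
  simp [walsh, ← Finset.prod_mul_distrib, boolSign_mul_self]

theorem walsh_sq {n : ℕ} (S : Finset (Fin n)) (b : Fin n → Bool) : walsh S b ^ 2 = 1 := by
  rw [sq, walsh_mul_self]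

theorem cubeAvg_walsh_mul_walsh {n : ℕ} (S T : Finset (Fin n)) :
    cubeAvg (fun b => walsh S b * walsh T b) = if S = T then 1 else 0 := by
  split_ifs with h
  · subst h
    simp [walsh_mul_self, cubeAvg_const]
  · obtain ⟨j, hj⟩ : ∃ j, ¬(j ∈ S ↔ j ∈ T) := by
      by_contra! hc
      exact h (Finset.ext hc)
    have key : ∀ b : Fin n → Bool, walsh S b * walsh T b =
        ∏ i, ((if i ∈ S then boolSign (b i) else 1) * (if i ∈ T then boolSign (b i) else 1)) := by
      intro b
      rw [Finset.prod_mul_distrib, Fintype.prod_ite_mem, Fintype.prod_ite_mem]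
      rfl
    have h2 := Finset.prod_univ_sum (fun _ : Fin n => (Finset.univ : Finset Bool))
      (fun i (c : Bool) => ((if i ∈ S then boolSign c else 1) * (if i ∈ T then boolSign c else 1)))
    rw [Fintype.piFinset_univ] at h2
    simp only [cubeAvg, key]
    rw [← h2, Finset.prod_eq_zero (Finset.mem_univ j), zero_div]
    by_cases h1 : j ∈ S <;> by_cases h3 : j ∈ T <;> simp_all [boolSign]

theorem sum_walsh_mul_walsh {n : ℕ} (b c : Fin n → Bool) :
    ∑ S, walsh S b * walsh S c = if b = c then 2 ^ n else 0 := by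
  have : ∑ S, walsh S b * walsh S c = ∏ j, (1 + boolSign (b j) * boolSign (c j)) := by
    rw [Finset.prod_one_add, Finset.powerset_univ]
    simp [walsh, Finset.prod_mul_distrib]
  rw [this]
  split_ifs with h
  · subst h
    simp [boolSign_mul_self]
    norm_num
  · obtain ⟨j, hj⟩ := Function.ne_iff.1 h
    apply Finset.prod_eq_zero (Finset.mem_univ j)
    revert hj
    cases b j <;> cases c j <;> simp [boolSign]

/-- The Fourier–Walsh coefficient of `f` at `S`. -/
noncomputable def walshCoeff {n : ℕ} (f : (Fin n → Bool) → ℝ) (S : Finset (Fin n)) : ℝ :=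
  cubeAvg (fun b => f b * walsh S b)

theorem cubeAvg_mul_eq_sum_walshCoeff {n : ℕ} (f g : (Fin n → Bool) → ℝ) :
    cubeAvg (fun b => f b * g b) = ∑ S, walshCoeff f S * walshCoeff g S := by
  have h : ∀ S, walshCoeff f S * walshCoeff g S =
      (∑ b, ∑ c, f b * g c * (walsh S b * walsh S c)) / (2 ^ n * 2 ^ n) := by
    intro S
    simp only [walshCoeff, cubeAvg, div_mul_div_comm, Finset.sum_mul_sum]
    congr 1
    refine Finset.sum_congr rfl fun b _ => Finset.sum_congr rfl fun c _ => by ring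
  simp only [h]
  rw [← Finset.sum_div, Finset.sum_comm]
  have h2 : ∀ b, ∑ S, ∑ c, f b * g c * (walsh S b * walsh S c) = f b * g b * 2 ^ n := by
    intro b
    rw [Finset.sum_comm]
    simp only [← Finset.mul_sum, sum_walsh_mul_walsh]
    simp
  simp only [h2]
  rw [← Finset.sum_mul, cubeAvg]
  field_simp

theorem cubeAvg_sq_walsh_sum {n : ℕ} (c : Finset (Fin n) → ℝ) :
    cubeAvg (fun b => (∑ S, c S * walsh S b) ^ 2) = ∑ S, c S ^ 2 := by
  have : ∀ b, (∑ S, c S * walsh S b) ^ 2 =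
      ∑ S, ∑ T, (c S * c T) * (walsh S b * walsh T b) := by
    intro b
    rw [sq, Finset.sum_mul_sum]
    refine Finset.sum_congr rfl fun S _ => Finset.sum_congr rfl fun T _ => by ring
  simp only [this, cubeAvg_sum, cubeAvg_const_mul, cubeAvg_walsh_mul_walsh]
  simp [sq]

/-! ### Bit flips and the sharp Khintchine inequality -/

/-- Flipping the bit `j`. -/
def flipBit {n : ℕ} (j : Fin n) : (Fin n → Bool) ≃ (Fin n → Bool) :=
  Function.Involutive.toPerm (fun b => Function.update b j (!b j)) (fun b => by simp)

theorem flipBit_self {n : ℕ} (j : Fin n) (b : Fin n → Bool) : flipBit j b j = !b j :=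
  Function.update_self ..

theorem flipBit_of_ne {n : ℕ} {i j : Fin n} (h : i ≠ j) (b : Fin n → Bool) :
    flipBit j b i = b i :=
  Function.update_of_ne h ..

/-- Flipping all bits. -/
def flipAll {n : ℕ} : (Fin n → Bool) ≃ (Fin n → Bool) :=
  Function.Involutive.toPerm (fun b i => !b i) (fun b => by simp)

theorem boolSign_flipAll {n : ℕ} (b : Fin n → Bool) (i : Fin n) :
    boolSign (flipAll b i) = -boolSign (b i) :=
  boolSign_not _

theorem walsh_flipBit {n : ℕ} (j : Fin n) (S : Finset (Fin n)) (b : Fin n → Bool) :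
    walsh S (flipBit j b) = (if j ∈ S then -1 else 1) * walsh S b := by
  split_ifs with h
  · rw [walsh, walsh, ← Finset.mul_prod_erase S _ h, ← Finset.mul_prod_erase S _ h,
      flipBit_self, boolSign_not, neg_mul, neg_one_mul]
    congr 2
    refine Finset.prod_congr rfl fun i hi => ?_
    rw [flipBit_of_ne (Finset.ne_of_mem_erase hi)]
  · rw [walsh, walsh, one_mul]
    refine Finset.prod_congr rfl fun i hi => ?_
    rw [flipBit_of_ne (ne_of_mem_of_not_mem hi h)]

theorem walshCoeff_flipBit {n : ℕ} (f : (Fin n → Bool) → ℝ) (j : Fin n) (S : Finset (Fin n)) :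
    walshCoeff (fun b => f (flipBit j b)) S = (if j ∈ S then -1 else 1) * walshCoeff f S := by
  unfold walshCoeff
  rw [← cubeAvg_comp_equiv (flipBit j) (fun b => f b * walsh S b), ← cubeAvg_const_mul]
  congr 1
  ext b
  rw [walsh_flipBit]
  split_ifs <;> ring

/-- Khintchine's inequality between the first and second moment, with the sharp constant. -/
theorem khintchine {n : ℕ} (a : Fin n → ℝ) (ha : ∑ j, a j ^ 2 = 1) :
    1 / 2 ≤ cubeAvg (fun b => |∑ j, a j * boolSign (b j)|) ^ 2 := by
  set f : (Fin n → Bool) → ℝ := fun b => |∑ j, a j * boolSign (b j)| with hf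
  have hsq : cubeAvg (fun b => f b * f b) = 1 := by
    have h : ∀ b, f b * f b = ∑ i, ∑ j, (a i * a j) * (walsh {i} b * walsh {j} b) := by
      intro b
      rw [hf, abs_mul_abs_self, Finset.sum_mul_sum]
      simp only [walsh, Finset.prod_singleton]
      refine Finset.sum_congr rfl fun i _ => Finset.sum_congr rfl fun j _ => by ring
    simp only [h, cubeAvg_sum, cubeAvg_const_mul, cubeAvg_walsh_mul_walsh]
    simpa [sq] using ha
  have hflip : ∀ (b : Fin n → Bool) (j : Fin n),
      ∑ i, a i * boolSign (flipBit j b i) =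
        ∑ i, a i * boolSign (b i) - 2 * (a j * boolSign (b j)) := by
    intro b j
    rw [eq_sub_iff_add_eq, ← Finset.add_sum_erase _ _ (Finset.mem_univ j),
      ← Finset.add_sum_erase (a := j) _ (fun i => a i * boolSign (b i)) (Finset.mem_univ j)]
    have h2 : ∑ i ∈ Finset.univ.erase j, a i * boolSign (flipBit j b i) =
        ∑ i ∈ Finset.univ.erase j, a i * boolSign (b i) := by
      refine Finset.sum_congr rfl fun i hi => ?_
      rw [flipBit_of_ne (Finset.ne_of_mem_erase hi)]
    rw [flipBit_self, h2, boolSign_not]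
    ring
  -- Latała–Oleszkiewicz argument: over all `n` single-bit flips each term changes sign exactly
  -- once, so the flipped sums add up to `n - 2` times the original. The triangle inequality then
  -- bounds `f` pointwise.
  have htri : ∀ b, ((n : ℝ) - 2) * f b ≤ ∑ j, f (flipBit j b) := by
    intro b
    have h1 : ∑ j, ∑ i, a i * boolSign (flipBit j b i) =
        ((n : ℝ) - 2) * ∑ i, a i * boolSign (b i) := by
      simp only [hflip, Finset.sum_sub_distrib, ← Finset.mul_sum]
      simp
      ring
    calc ((n : ℝ) - 2) * f b ≤ |((n : ℝ) - 2) * ∑ i, a i * boolSign (b i)| := by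
          rw [abs_mul]
          exact mul_le_mul_of_nonneg_right (le_abs_self _) (abs_nonneg _)
      _ ≤ _ := by
          rw [← h1]
          exact Finset.abs_sum_le_sum_abs _ _
  have hlow : (n : ℝ) - 2 ≤ cubeAvg (fun b => f b * ∑ j, f (flipBit j b)) := by
    calc (n : ℝ) - 2 = cubeAvg (fun b => ((n : ℝ) - 2) * (f b * f b)) := by
          rw [cubeAvg_const_mul, hsq, mul_one]
      _ ≤ _ := cubeAvg_mono fun b => by
          nlinarith [htri b, abs_nonneg (∑ j, a j * boolSign (b j))]
  have hspec : cubeAvg (fun b => f b * ∑ j, f (flipBit j b)) =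
      ∑ S, ((n : ℝ) - 2 * S.card) * walshCoeff f S ^ 2 := by
    simp only [Finset.mul_sum, cubeAvg_sum]
    simp only [cubeAvg_mul_eq_sum_walshCoeff f (fun b => f (flipBit _ b)), walshCoeff_flipBit]
    rw [Finset.sum_comm]
    refine Finset.sum_congr rfl fun S _ => ?_
    have : ∑ j : Fin n, (if j ∈ S then (-1 : ℝ) else 1) = (n : ℝ) - 2 * S.card := by
      have : ∀ j : Fin n, (if j ∈ S then (-1 : ℝ) else 1) = 1 - 2 * (if j ∈ S then 1 else 0) := by
        intro j; split_ifs <;> norm_num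
      simp only [this, Finset.sum_sub_distrib, ← Finset.mul_sum]
      simp
    rw [← this, Finset.sum_mul]
    refine Finset.sum_congr rfl fun j _ => by ring
  have hpar : ∑ S, walshCoeff f S ^ 2 = 1 := by
    rw [← hsq, cubeAvg_mul_eq_sum_walshCoeff]
    simp [sq]
  -- `f` is even under the global flip, so level one vanishes. Away from `∅` the multiplier `n -
  -- 2|S|` is thus effectively at most `n - 4`, which beats the `n - 2` of `hlow` and forces weight
  -- at least `1/2` on `∅`.
  have hodd : ∀ j, walshCoeff f {j} = 0 := by
    intro j
    have h1 : walshCoeff f {j} = cubeAvg (fun b => f (flipAll b) * walsh {j} (flipAll b)) :=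
      (cubeAvg_comp_equiv flipAll (fun b => f b * walsh {j} b)).symm
    have h2 : ∀ b, f (flipAll b) * walsh {j} (flipAll b) = (-1) * (f b * walsh {j} b) := by
      intro b
      simp [hf, walsh, boolSign_flipAll]
    simp only [h2, cubeAvg_const_mul] at h1
    change _ = -1 * walshCoeff f {j} at h1
    linarith
  have hempty : walshCoeff f ∅ = cubeAvg f := by simp [walshCoeff, walsh]
  have hup : ∑ S, ((n : ℝ) - 2 * S.card) * walshCoeff f S ^ 2 ≤
      ∑ S, (((n : ℝ) - 4) * walshCoeff f S ^ 2 + if S = ∅ then 4 * walshCoeff f S ^ 2 else 0) := by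
    refine Finset.sum_le_sum fun S _ => ?_
    split_ifs with h
    · subst h
      simp
      linarith
    · rcases (Nat.succ_le_of_lt (Finset.card_pos.2 (Finset.nonempty_iff_ne_empty.2 h))).eq_or_lt with h1 | h1
      · obtain ⟨j, rfl⟩ := Finset.card_eq_one.1 h1.symm
        simp [hodd]
      · have : (2 : ℝ) ≤ S.card := by exact_mod_cast h1
        nlinarith [sq_nonneg (walshCoeff f S)]
  rw [Finset.sum_add_distrib, ← Finset.mul_sum, hpar] at hup
  simp only [Finset.sum_ite_eq', Finset.mem_univ, if_true, hempty] at hup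
  linarith

/-! ### Convex transport on the cube -/

theorem cubeAvg_succ {n : ℕ} (f : (Fin (n + 1) → Bool) → ℝ) :
    cubeAvg f = (cubeAvg (fun b => f (Fin.cons false b)) +
      cubeAvg (fun b => f (Fin.cons true b))) / 2 := by
  unfold cubeAvg
  rw [← (Fin.consEquiv fun _ : Fin (n + 1) => Bool).sum_comp f, Fintype.sum_prod_type]
  simp [Fin.consEquiv]
  field_simp
  ring

/-- Replaces `cosh x ≤ exp (x² / 2)` when the optimal displacement is truncated at `1`. After
dividing by `exp x` the worst case is `x = 1`, where `(e⁻² + 1) / 2 ≤ e^{-1/2}`. -/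
theorem cosh_le_exp_sub_half {x : ℝ} (hx : 1 ≤ x) : Real.cosh x ≤ Real.exp (x - 1 / 2) := by
  have h1 : Real.exp (-x) ≤ Real.exp x * Real.exp (-2) := by
    rw [← Real.exp_add]; exact Real.exp_le_exp.2 (by linarith)
  have h2 : (Real.exp (-2) + 1) / 2 ≤ Real.exp (-(1 / 2)) := by
    have h3 : Real.exp (-2) ≤ 0.15 := by
      have := Real.exp_one_gt_d9
      have h4 : Real.exp 2 = Real.exp 1 * Real.exp 1 := by rw [← Real.exp_add]; norm_num
      rw [Real.exp_neg, h4]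
      rw [inv_le_comm₀ (by positivity) (by norm_num)]
      nlinarith
    have h5 : (0.6 : ℝ) ≤ Real.exp (-(1 / 2)) := by
      have := Real.exp_one_lt_d9
      have h4 : Real.exp (1 / 2) * Real.exp (1 / 2) = Real.exp 1 := by
        rw [← Real.exp_add]; norm_num
      rw [Real.exp_neg, le_inv_comm₀ (by norm_num) (by positivity)]
      nlinarith [Real.exp_pos (1 / 2)]
    linarith
  rw [Real.cosh_eq, sub_eq_add_neg, Real.exp_add]
  nlinarith [Real.exp_pos x]

/-- The one-dimensional optimisation behind `exists_convex_transport`. -/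
theorem exists_unit_interval_transport {a b : ℝ} (hab : b ≤ a) :
    ∃ q : ℝ, 0 ≤ q ∧ q ≤ 1 ∧ (Real.exp (-a) + Real.exp (-b)) / 2 ≤
      Real.exp (-(((1 - q) * a + q * b + q ^ 2 + b) / 2)) := by
  have hcosh : (Real.exp (-a) + Real.exp (-b)) / 2 =
      Real.exp (-((a + b) / 2)) * Real.cosh ((a - b) / 2) := by
    rw [Real.cosh_eq, mul_div_assoc', mul_add, ← Real.exp_add, ← Real.exp_add]
    ring_nf
  rw [hcosh]
  rcases le_total (a - b) 2 with h | h
  -- This `q` minimises `q ^ 2 - q * (a - b)`; the other case truncates it at `1`.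
  · refine ⟨(a - b) / 2, by linarith, by linarith, ?_⟩
    calc _ ≤ Real.exp (-((a + b) / 2)) * Real.exp (((a - b) / 2) ^ 2 / 2) := by
          gcongr
          exact Real.cosh_le_exp_half_sq _
      _ = _ := by
          rw [← Real.exp_add]
          ring_nf
  · refine ⟨1, by norm_num, le_rfl, ?_⟩
    calc _ ≤ Real.exp (-((a + b) / 2)) * Real.exp ((a - b) / 2 - 1 / 2) := by
          gcongr
          exact cosh_le_exp_sub_half (by linarith)
      _ = _ := by
          rw [← Real.exp_add]
          ring_nf

/-- The transport cost of moving `u` to `y`, with potential `f`. -/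
def transportCost {n : ℕ} (f : (Fin n → ℝ) → ℝ) (u : Fin n → Bool) (y : Fin n → ℝ) : ℝ :=
  f y + ∑ j, (bitVec u j - y j) ^ 2

theorem bitVec_cons {n : ℕ} (c : Bool) (u : Fin n → Bool) :
    bitVec (Fin.cons c u) = Fin.cons (if c then 1 else 0) (bitVec u) := by
  ext j
  refine Fin.cases ?_ (fun i => ?_) j <;> simp [bitVec]

/-- Inductive step of the transport: a target interpolated between the two slices costs, by
convexity of `f` and of the square, the interpolated slice costs plus the displacement in the new
coordinate. -/
theorem transportCost_cons_le {n : ℕ} {f : (Fin (n + 1) → ℝ) → ℝ} (hf : ConvexOn ℝ Set.univ f)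
    (c : Bool) (u : Fin n → Bool) (s t : ℝ) (y z : Fin n → ℝ) {q : ℝ} (h0 : 0 ≤ q) (h1 : q ≤ 1) :
    transportCost f (Fin.cons c u) ((1 - q) • (Fin.cons s y : Fin (n + 1) → ℝ)
        + q • (Fin.cons t z : Fin (n + 1) → ℝ)) ≤
      (1 - q) * transportCost (fun x => f (Fin.cons s x)) u y +
        q * transportCost (fun x => f (Fin.cons t x)) u z +
        ((if c then 1 else 0) - ((1 - q) * s + q * t)) ^ 2 := by
  have hc := hf.2 (Set.mem_univ (Fin.cons s y)) (Set.mem_univ (Fin.cons t z))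
    (sub_nonneg.2 h1) h0 (by ring)
  simp only [smul_eq_mul] at hc
  have hs : ∑ j, (bitVec u j - ((1 - q) * y j + q * z j)) ^ 2 ≤
      (1 - q) * ∑ j, (bitVec u j - y j) ^ 2 + q * ∑ j, (bitVec u j - z j) ^ 2 := by
    rw [Finset.mul_sum, Finset.mul_sum, ← Finset.sum_add_distrib]
    refine Finset.sum_le_sum fun j _ => ?_
    nlinarith [mul_nonneg (mul_nonneg h0 (sub_nonneg.2 h1)) (sq_nonneg (y j - z j))]
  simp only [transportCost, Fin.sum_univ_succ, bitVec_cons, Fin.cons_zero, Fin.cons_succ,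
    Pi.add_apply, Pi.smul_apply, smul_eq_mul]
  nlinarith

theorem convexOn_comp_cons {n : ℕ} {f : (Fin (n + 1) → ℝ) → ℝ} (hf : ConvexOn ℝ Set.univ f)
    (s : ℝ) : ConvexOn ℝ Set.univ (fun x : Fin n → ℝ => f (Fin.cons s x)) := by
  refine ⟨convex_univ, fun x _ y _ a b ha hb hab => ?_⟩
  have := hf.2 (Set.mem_univ (Fin.cons s x)) (Set.mem_univ (Fin.cons s y)) ha hb hab
  convert this using 2
  ext j
  refine Fin.cases ?_ (fun i => ?_) j
  · simp [← add_mul, hab]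
  · simp

/-- A transport inequality for convex functions on the uniform Boolean cube. -/
theorem exists_convex_transport {n : ℕ} (f : (Fin n → ℝ) → ℝ) (hf : ConvexOn ℝ Set.univ f) :
    ∃ Y : (Fin n → Bool) → (Fin n → ℝ),
      cubeAvg (fun u => Real.exp (-f (bitVec u))) ≤
        Real.exp (-cubeAvg (fun u => transportCost f u (Y u))) := by
  induction n with
  | zero =>
    refine ⟨bitVec, ?_⟩
    simp [cubeAvg, transportCost]
  | succ n ih =>
    obtain ⟨Y, hY⟩ := ih _ (convexOn_comp_cons hf 0)
    obtain ⟨Z, hZ⟩ := ih _ (convexOn_comp_cons hf 1)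
    set a := cubeAvg (fun u => transportCost (fun x => f (Fin.cons 0 x)) u (Y u)) with ha
    set b := cubeAvg (fun u => transportCost (fun x => f (Fin.cons 1 x)) u (Z u)) with hb
    -- `p` and `q` are the interpolation weights used when the first bit is `0` and `1`. The bit on
    -- the cheaper face stays put; the other moves towards it.
    have key : ∃ p q : ℝ, 0 ≤ p ∧ p ≤ 1 ∧ 0 ≤ q ∧ q ≤ 1 ∧
        (Real.exp (-a) + Real.exp (-b)) / 2 ≤
          Real.exp (-((((1 - p) * a + p * b + p ^ 2) + ((1 - q) * a + q * b + (1 - q) ^ 2)) / 2)) := by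
      rcases le_total b a with h | h
      · obtain ⟨q, h0, h1, h2⟩ := exists_unit_interval_transport h
        refine ⟨q, 1, h0, h1, by norm_num, le_rfl, h2.trans (le_of_eq ?_)⟩
        ring_nf
      · obtain ⟨q, h0, h1, h2⟩ := exists_unit_interval_transport h
        refine ⟨0, 1 - q, le_rfl, by norm_num, by linarith, by linarith, ?_⟩
        rw [add_comm]
        refine h2.trans (le_of_eq ?_)
        ring_nf
    obtain ⟨p, q, hp0, hp1, hq0, hq1, hpq⟩ := key
    have havg : ∀ (r : ℝ) (c : Bool), 0 ≤ r → r ≤ 1 →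
        cubeAvg (fun u => transportCost f (Fin.cons c u)
          ((1 - r) • (Fin.cons 0 (Y u) : Fin (n + 1) → ℝ) +
            r • (Fin.cons 1 (Z u) : Fin (n + 1) → ℝ))) ≤
          (1 - r) * a + r * b + ((if c then 1 else 0) - r) ^ 2 := by
      intro r c h0 h1
      refine (cubeAvg_mono fun u => transportCost_cons_le hf c u 0 1 (Y u) (Z u) h0 h1).trans ?_
      rw [cubeAvg_add, cubeAvg_add, cubeAvg_const_mul, cubeAvg_const_mul, cubeAvg_const, ← ha, ← hb]
      simp
    refine ⟨fun u => (1 - if u 0 then q else p) • (Fin.cons 0 (Y (Fin.tail u)) : Fin (n + 1) → ℝ) +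
            (if u 0 then q else p) • (Fin.cons 1 (Z (Fin.tail u)) : Fin (n + 1) → ℝ), ?_⟩
    rw [cubeAvg_succ, cubeAvg_succ]
    simp only [bitVec_cons, Fin.cons_zero, Fin.tail_cons, if_true, Bool.false_eq_true, if_false]
    have h1 := havg p false hp0 hp1
    have h2 := havg q true hq0 hq1
    simp only [if_true, Bool.false_eq_true, if_false] at h1 h2
    refine ((by linarith : _ ≤ (Real.exp (-a) + Real.exp (-b)) / 2).trans hpq).trans ?_
    refine Real.exp_le_exp.2 ?_
    linarith

/-! ### High overlap with a fixed string is exponentially rare -/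

theorem bitVec_eq_boolSign {d : ℕ} (b : Fin d → Bool) (j : Fin d) :
    bitVec b j = (1 - boolSign (b j)) / 2 := by
  cases h : b j <;> simp [bitVec, boolSign, h]

/-- The `ℓ₁`-norm of `O (x - c)`. -/
def l1Dist {d : ℕ} (O : Matrix (Fin d) (Fin d) ℝ) (c x : Fin d → ℝ) : ℝ :=
  ∑ i, |(O *ᵥ (x - c)) i|

theorem convexOn_l1Dist {d : ℕ} (O : Matrix (Fin d) (Fin d) ℝ) (c : Fin d → ℝ) :
    ConvexOn ℝ Set.univ (l1Dist O c) := by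
  refine ⟨convex_univ, fun x _ y _ a b ha hb hab => ?_⟩
  have h : a • x + b • y - c = a • (x - c) + b • (y - c) := by
    have : c = (a + b) • c := by rw [hab, one_smul]
    nth_rewrite 1 [this]
    module
  simp only [l1Dist, smul_eq_mul, Finset.mul_sum]
  rw [← Finset.sum_add_distrib]
  refine Finset.sum_le_sum fun i _ => ?_
  rw [h, Matrix.mulVec_add, Matrix.mulVec_smul, Matrix.mulVec_smul]
  refine (abs_add_le _ _).trans_eq ?_
  simp [abs_mul, abs_of_nonneg ha, abs_of_nonneg hb]

theorem exists_subgradient_l1Dist {d : ℕ} {O : Matrix (Fin d) (Fin d) ℝ}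
    (hO : O ∈ Matrix.orthogonalGroup (Fin d) ℝ) (c x : Fin d → ℝ) :
    ∃ g : Fin d → ℝ, ∑ j, g j ^ 2 = d ∧
      ∀ y, l1Dist O c x + ∑ j, g j * (y j - x j) ≤ l1Dist O c y := by
  -- Taking the sign at `0` to be `1` makes every entry `±1`, so the subgradient `Oᵀ s` has squared
  -- norm exactly `d`.
  set s : Fin d → ℝ := fun i => if 0 ≤ (O *ᵥ (x - c)) i then 1 else -1 with hs
  have hs1 : ∀ i, s i * s i = 1 := by
    intro i
    simp only [hs]
    split_ifs <;> norm_num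
  refine ⟨s ᵥ* O, ?_, fun y => ?_⟩
  · have h1 : ∑ j, (s ᵥ* O) j ^ 2 = (s ᵥ* O) ⬝ᵥ (s ᵥ* O) := by simp [dotProduct, sq]
    have h2 : O * Oᵀ = 1 := by
      simpa [Matrix.star_eq_conjTranspose] using (Matrix.mem_orthogonalGroup_iff (Fin d) ℝ).1 hO
    rw [h1, ← Matrix.dotProduct_mulVec,
      ← Matrix.mulVec_transpose O s, Matrix.mulVec_mulVec, h2, Matrix.one_mulVec]
    simp [dotProduct, hs1]
  · have h1 : l1Dist O c x = ∑ i, s i * (O *ᵥ (x - c)) i := by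
      refine Finset.sum_congr rfl fun i _ => ?_
      simp only [hs]
      split_ifs with h
      · rw [abs_of_nonneg h, one_mul]
      · rw [abs_of_neg (not_le.1 h), neg_one_mul]
    have h2 : ∑ j, (s ᵥ* O) j * (y j - x j) = ∑ i, s i * (O *ᵥ (y - x)) i :=
      (Matrix.dotProduct_mulVec s O (y - x)).symm
    rw [h1, h2, ← Finset.sum_add_distrib]
    refine Finset.sum_le_sum fun i _ => ?_
    have h3 : y - c = (x - c) + (y - x) := by abel
    rw [← mul_add, ← Pi.add_apply, ← Matrix.mulVec_add, ← h3]
    refine (le_abs_self _).trans_eq ?_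
    rw [abs_mul]
    have : |s i| = 1 := by
      simp only [hs]
      split_ifs <;> simp
    rw [this, one_mul]

/-- Coordinate `i` equals `m - X / 2` with `X` a unit-norm Rademacher sum. By symmetry of `X` and
the triangle inequality the shift `m` is harmless, so its mean modulus is at least `E|X| / 2 ≥ 1 /
(2√2) > 0.353`. -/
theorem cubeAvg_l1Dist_ge {d : ℕ} {O : Matrix (Fin d) (Fin d) ℝ}
    (hO : O ∈ Matrix.orthogonalGroup (Fin d) ℝ) (c : Fin d → ℝ) :
    353 / 1000 * (d : ℝ) ≤ cubeAvg (fun u => l1Dist O c (bitVec u)) := by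
  have h2 : O * Oᵀ = 1 := by
    simpa [Matrix.star_eq_conjTranspose] using (Matrix.mem_orthogonalGroup_iff (Fin d) ℝ).1 hO
  have hrow : ∀ i, 353 / 1000 ≤ cubeAvg (fun u => |(O *ᵥ (bitVec u - c)) i|) := by
    intro i
    have hi : ∑ j, O i j ^ 2 = 1 := by
      have := congrFun (congrFun h2 i) i
      simpa [Matrix.mul_apply, sq] using this
    have hk := khintchine (O i) hi
    have hpos : 0 ≤ cubeAvg (fun b => |∑ j, O i j * boolSign (b j)|) :=
      div_nonneg (Finset.sum_nonneg fun _ _ => abs_nonneg _) (by positivity)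
    set m := ∑ j, O i j * (1 / 2 - c j) with hm
    have hval : ∀ u, (O *ᵥ (bitVec u - c)) i = m - (∑ j, O i j * boolSign (u j)) / 2 := by
      intro u
      rw [hm, Finset.sum_div, ← Finset.sum_sub_distrib, Matrix.mulVec, dotProduct]
      refine Finset.sum_congr rfl fun j _ => ?_
      rw [Pi.sub_apply, bitVec_eq_boolSign]
      ring
    have hneg : cubeAvg (fun u => |m + (∑ j, O i j * boolSign (u j)) / 2|) =
        cubeAvg (fun u => |m - (∑ j, O i j * boolSign (u j)) / 2|) := by
      rw [← cubeAvg_comp_equiv flipAll]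
      congr 1
      ext u
      simp only [boolSign_flipAll, mul_neg, Finset.sum_neg_distrib]
      ring_nf
    have hsum : cubeAvg (fun b => |∑ j, O i j * boolSign (b j)|) ≤
        cubeAvg (fun u => |m + (∑ j, O i j * boolSign (u j)) / 2|) +
        cubeAvg (fun u => |m - (∑ j, O i j * boolSign (u j)) / 2|) := by
      rw [← cubeAvg_add]
      refine cubeAvg_mono fun b => ?_
      refine le_trans (le_of_eq ?_) (abs_sub _ _)
      congr 1
      ring
    simp only [hval]
    nlinarith
  simp only [l1Dist, cubeAvg_sum]
  calc 353 / 1000 * (d : ℝ) = ∑ _i : Fin d, (353 / 1000 : ℝ) := by simp; ring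
    _ ≤ _ := Finset.sum_le_sum fun i _ => hrow i

open Classical in
/-- A uniformly random bit string has high overlap with a fixed one only with exponentially small
probability. -/
theorem cubeAvg_highOverlap_le {d : ℕ} {O : Matrix (Fin d) (Fin d) ℝ}
    (hO : O ∈ Matrix.orthogonalGroup (Fin d) ℝ) (b' : Fin d → Bool) :
    cubeAvg (fun b => if HighOverlap O b b' then 1 else 0) ≤ Real.exp (-(53 / 5000 * (d : ℝ))) := by
  set F := l1Dist O (bitVec b') with hF
  -- With slope `λ` the exponent per dimension is `λ/4 - 0.353 λ + λ²/4`; `λ = 1/5` is close to its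
  -- minimiser `0.206` and yields `-53/5000`.
  obtain ⟨Y, hY⟩ := exists_convex_transport (fun x => 1 / 5 * F x)
    ((convexOn_l1Dist O (bitVec b')).smul (by norm_num : (0 : ℝ) ≤ 1 / 5))
  have hcost : ∀ u, 1 / 5 * F (bitVec u) + -(d / 100 : ℝ) ≤
      transportCost (fun x => 1 / 5 * F x) u (Y u) := by
    intro u
    obtain ⟨g, hg, hsub⟩ := exists_subgradient_l1Dist hO (bitVec b') (bitVec u)
    have h1 := hsub (Y u)
    have h2 : -(1 / 100 * ∑ j, g j ^ 2) ≤
        1 / 5 * ∑ j, g j * (Y u j - bitVec u j) + ∑ j, (bitVec u j - Y u j) ^ 2 := by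
      rw [Finset.mul_sum, Finset.mul_sum, ← Finset.sum_add_distrib, ← Finset.sum_neg_distrib]
      refine Finset.sum_le_sum fun j _ => ?_
      -- Completing the square: the quadratic cost absorbs the linear term at a loss of `λ² g_j² /
      -- 4`.
      nlinarith [sq_nonneg (1 / 10 * g j + (Y u j - bitVec u j))]
    rw [hg] at h2
    unfold transportCost
    linarith
  have havg := cubeAvg_mono hcost
  rw [cubeAvg_add, cubeAvg_const_mul, cubeAvg_const] at havg
  have hlow := cubeAvg_l1Dist_ge hO (bitVec b')
  have hind : ∀ b, (if HighOverlap O b b' then (1 : ℝ) else 0) ≤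
      Real.exp (d / 20) * Real.exp (-(1 / 5 * F (bitVec b))) := by
    intro b
    split_ifs with h
    · have h1 : F (bitVec b) ≤ d / 4 := h
      rw [← Real.exp_add]
      exact Real.one_le_exp (by linarith)
    · positivity
  refine (cubeAvg_mono hind).trans ?_
  rw [cubeAvg_const_mul]
  refine (mul_le_mul_of_nonneg_left hY (Real.exp_pos _).le).trans ?_
  rw [← Real.exp_add]
  refine Real.exp_le_exp.2 ?_
  linarith

/-! ### Low-degree polynomials on the cube -/

/-- The functions on the Boolean cube whose Fourier–Walsh expansion has degree at most `k`. -/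
def walshDegreeLE (d k : ℕ) : Submodule ℂ ((Fin d → Bool) → ℂ) where
  carrier := {p | ∃ c : Finset (Fin d) → ℂ, (∀ S, k < S.card → c S = 0) ∧
    ∀ b, p b = ∑ S, c S * (walsh S b : ℝ)}
  add_mem' := by
    rintro p q ⟨c, hc, hp⟩ ⟨e, he, hq⟩
    refine ⟨c + e, fun S hS => by simp [hc S hS, he S hS], fun b => ?_⟩
    simp [hp, hq, add_mul, Finset.sum_add_distrib]
  zero_mem' := ⟨0, by simp⟩
  smul_mem' := by
    rintro a p ⟨c, hc, hp⟩
    refine ⟨a • c, fun S hS => by simp [hc S hS], fun b => ?_⟩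
    simp [hp, Finset.mul_sum, mul_assoc]

theorem walshDegreeLE_mono {d k l : ℕ} (h : k ≤ l) : walshDegreeLE d k ≤ walshDegreeLE d l := by
  rintro p ⟨c, hc, hp⟩
  exact ⟨c, fun S hS => hc S (h.trans_lt hS), hp⟩

theorem walsh_mem_walshDegreeLE {d k : ℕ} {S : Finset (Fin d)} (hS : S.card ≤ k) :
    (fun b => ((walsh S b : ℝ) : ℂ)) ∈ walshDegreeLE d k := by
  refine ⟨Pi.single S 1, fun T hT => Pi.single_eq_of_ne (by rintro rfl; omega) _, fun b => ?_⟩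
  simp [Pi.single_apply]

theorem exists_walsh_mul_boolSign {d : ℕ} (S : Finset (Fin d)) (j : Fin d) :
    ∃ T : Finset (Fin d), T.card ≤ S.card + 1 ∧
      ∀ b : Fin d → Bool, boolSign (b j) * walsh S b = walsh T b := by
  by_cases h : j ∈ S
  · refine ⟨S.erase j, by have := Finset.card_erase_le (s := S) (a := j); omega, fun b => ?_⟩
    rw [walsh, ← Finset.mul_prod_erase S _ h, ← mul_assoc, boolSign_mul_self, one_mul, walsh]
  · exact ⟨insert j S, Finset.card_insert_le _ _, fun b => by rw [walsh, walsh, Finset.prod_insert h]⟩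

theorem boolSign_mul_mem_walshDegreeLE {d k : ℕ} {p : (Fin d → Bool) → ℂ}
    (hp : p ∈ walshDegreeLE d k) (j : Fin d) :
    (fun b => ((boolSign (b j) : ℝ) : ℂ) * p b) ∈ walshDegreeLE d (k + 1) := by
  obtain ⟨c, hc, hp⟩ := hp
  have h : (fun b => ((boolSign (b j) : ℝ) : ℂ) * p b) =
      ∑ S, c S • fun b => ((boolSign (b j) * walsh S b : ℝ) : ℂ) := by
    ext b
    simp only [hp, Finset.mul_sum, Finset.sum_apply, Pi.smul_apply, smul_eq_mul]
    refine Finset.sum_congr rfl fun S _ => ?_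
    push_cast
    ring
  rw [h]
  refine Submodule.sum_mem _ fun S _ => ?_
  rcases le_or_gt S.card k with hS | hS
  · obtain ⟨T, hT, hb⟩ := exists_walsh_mul_boolSign S j
    simp only [hb]
    exact Submodule.smul_mem _ _ (walsh_mem_walshDegreeLE (by omega))
  · simp [hc S hS]

/-- The number of Walsh functions of degree at most `k`. -/
def walshDim (d k : ℕ) : ℕ :=
  (Finset.univ.filter fun S : Finset (Fin d) => S.card ≤ k).card

/-- Chernoff-type count: each `S` with at most `k` elements has weight `1024 ^ (k - |S|) ≥ 1`, and
the sum of `1024 ^ (-|S|)` over all `S` factorises. -/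
theorem walshDim_le (d k : ℕ) : (walshDim d k : ℝ) ≤ 1024 ^ k * (1 + 1 / 1024) ^ d := by
  have h1 : ∑ S : Finset (Fin d), (1 / 1024 : ℝ) ^ S.card = (1 + 1 / 1024) ^ d := by
    have := Fintype.sum_pow_mul_eq_add_pow (Fin d) (1 / 1024 : ℝ) 1
    simpa [add_comm] using this
  rw [walshDim, Finset.card_eq_sum_ones, Nat.cast_sum, ← h1, Finset.mul_sum]
  calc _ ≤ ∑ S : Finset (Fin d) with S.card ≤ k, (1024 : ℝ) ^ k * (1 / 1024) ^ S.card := by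
        refine Finset.sum_le_sum fun S hS => ?_
        rw [Nat.cast_one, div_pow, one_pow, mul_one_div, one_le_div (by positivity)]
        exact pow_le_pow_right₀ (by norm_num) (Finset.mem_filter.1 hS).2
    _ ≤ _ := Finset.sum_le_sum_of_subset_of_nonneg (Finset.filter_subset _ _)
        fun _ _ _ => by positivity

/-- Cauchy–Schwarz over the at most `walshDim d k` nonzero terms, with Parseval for the mean square.
-/
theorem sq_walsh_sum_le {d k : ℕ} (c : Finset (Fin d) → ℝ) (hc : ∀ S, k < S.card → c S = 0)
    (b : Fin d → Bool) :
    (∑ S, c S * walsh S b) ^ 2 ≤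
      walshDim d k * cubeAvg (fun b => (∑ S, c S * walsh S b) ^ 2) := by
  rw [cubeAvg_sq_walsh_sum]
  have h1 : ∑ S, c S * walsh S b =
      ∑ S : Finset (Fin d) with S.card ≤ k, c S * walsh S b := by
    symm
    refine Finset.sum_subset (Finset.filter_subset _ _) fun S _ hS => ?_
    rw [hc S (by simpa using hS), zero_mul]
  rw [h1]
  refine sq_sum_le_card_mul_sum_sq.trans ?_
  refine mul_le_mul_of_nonneg_left ?_ (Nat.cast_nonneg _)
  simp only [mul_pow, walsh_sq, mul_one]
  exact Finset.sum_le_sum_of_subset_of_nonneg (Finset.filter_subset _ _)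
    fun _ _ _ => sq_nonneg _

theorem norm_sq_le_walshDim_mul {d k : ℕ} {p : (Fin d → Bool) → ℂ} (hp : p ∈ walshDegreeLE d k)
    (b : Fin d → Bool) : ‖p b‖ ^ 2 ≤ walshDim d k * cubeAvg (fun b => ‖p b‖ ^ 2) := by
  obtain ⟨c, hc, hp⟩ := hp
  have h : ∀ b, ‖p b‖ ^ 2 =
      (∑ S, (c S).re * walsh S b) ^ 2 + (∑ S, (c S).im * walsh S b) ^ 2 := by
    intro b
    rw [hp, Complex.sq_norm, Complex.normSq_apply]
    simp [sq]
  simp only [h, cubeAvg_add, mul_add]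
  exact add_le_add (sq_walsh_sum_le _ (fun S hS => by simp [hc S hS]) b)
    (sq_walsh_sum_le _ (fun S hS => by simp [hc S hS]) b)

/-! ### Polynomial method for query algorithms -/

theorem sum_norm_sq_mulVec_of_unitary {ι : Type*} [Fintype ι] [DecidableEq ι]
    {U : Matrix ι ι ℂ} (hU : U ∈ Matrix.unitaryGroup ι ℂ) (v : ι → ℂ) :
    ∑ x, ‖(U *ᵥ v) x‖ ^ 2 = ∑ x, ‖v x‖ ^ 2 := by
  have key : ∀ w : ι → ℂ, ((∑ x, ‖w x‖ ^ 2 : ℝ) : ℂ) = star w ⬝ᵥ w := by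
    intro w
    simp [dotProduct, Complex.conj_mul']
  have hU' : Uᴴ * U = 1 := Matrix.mem_unitaryGroup_iff'.1 hU
  apply Complex.ofReal_injective
  rw [key, key, Matrix.star_mulVec, Matrix.dotProduct_mulVec, Matrix.vecMul_vecMul, hU',
    Matrix.vecMul_one]

namespace QueryAlgorithm

theorem controlledPhaseOracle_mulVec {d m : ℕ} (b : Fin d → Bool) (v : QueryBasis d m → ℂ)
    (x : QueryBasis d m) : (controlledPhaseOracle m b *ᵥ v) x =
      (if x.1 then ((boolSign (b x.2.1) : ℝ) : ℂ) else 1) * v x := by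
  rw [controlledPhaseOracle, Matrix.mulVec_diagonal]
  cases b x.2.1 <;> simp [boolSign]

theorem sum_norm_sq_state {d : ℕ} (A : QueryAlgorithm d) (b : Fin d → Bool) (t : ℕ) :
    ∑ x, ‖A.state b t x‖ ^ 2 = 1 := by
  induction t with
  | zero =>
    rw [state, sum_norm_sq_mulVec_of_unitary (A.U 0).2]
    simp [Pi.single_apply, apply_ite]
  | succ t ih =>
    rw [state, sum_norm_sq_mulVec_of_unitary (A.U (t + 1)).2, ← ih]
    refine Finset.sum_congr rfl fun x _ => ?_
    rw [controlledPhaseOracle_mulVec, norm_mul]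
    cases x.1 <;> cases b x.2.1 <;> simp [boolSign]

/-- After `t` queries, every amplitude is a polynomial of degree at most `t` in the signs of the
bits. -/
theorem state_mem_walshDegreeLE {d : ℕ} (A : QueryAlgorithm d) (t : ℕ)
    (x : QueryBasis d A.workDim) : (fun b => A.state b t x) ∈ walshDegreeLE d t := by
  induction t generalizing x with
  | zero =>
    have h : (fun b => A.state b 0 x) =
        (((A.U 0).1 *ᵥ Pi.single A.start 1) x) • fun b => ((walsh ∅ b : ℝ) : ℂ) := by
      ext b
      simp [state, walsh]
    rw [h]
    exact Submodule.smul_mem _ _ (walsh_mem_walshDegreeLE (by simp))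
  | succ t ih =>
    have h : (fun b => A.state b (t + 1) x) = ∑ y, (A.U (t + 1)).1 x y •
        fun b => (if y.1 then ((boolSign (b y.2.1) : ℝ) : ℂ) else 1) * A.state b t y := by
      ext b
      rw [state, Matrix.mulVec, dotProduct]
      simp only [controlledPhaseOracle_mulVec, Finset.sum_apply, Pi.smul_apply, smul_eq_mul]
    rw [h]
    refine Submodule.sum_mem _ fun y _ => Submodule.smul_mem _ _ ?_
    cases y.1
    · simpa using walshDegreeLE_mono t.le_succ (ih y)
    · simpa using boolSign_mul_mem_walshDegreeLE (ih y) y.2.1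

/-- If every fixed output is acceptable for at most a fraction `ε` of the inputs, the average
success probability is at most `ε` times the number of Walsh functions of degree at most the
number of queries. -/
theorem cubeAvg_outputProb_le {d : ℕ} (A : QueryAlgorithm d)
    (R : (Fin d → Bool) → (Fin d → Bool) → Prop) [∀ b b', Decidable (R b b')] {ε : ℝ}
    (hε : ∀ b', cubeAvg (fun b => if R b b' then 1 else 0) ≤ ε) :
    cubeAvg (fun b => A.outputProb b (R b)) ≤ walshDim d A.queries * ε := by
  set D := (walshDim d A.queries : ℝ)
  have hprob : ∀ b, A.outputProb b (R b) =
      ∑ x, ‖A.state b A.queries x‖ ^ 2 * (if R b (A.output x) then 1 else 0) := by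
    intro b
    rw [outputProb, Finset.sum_filter]
    refine Finset.sum_congr rfl fun x _ => ?_
    by_cases h : R b (A.output x) <;> simp [h]
  have hnonneg : ∀ x, 0 ≤ D * cubeAvg (fun b => ‖A.state b A.queries x‖ ^ 2) := fun x =>
    mul_nonneg (Nat.cast_nonneg _)
      (div_nonneg (Finset.sum_nonneg fun _ _ => by positivity) (by positivity))
  simp only [hprob, cubeAvg_sum]
  calc _ ≤ ∑ x, D * cubeAvg (fun b => ‖A.state b A.queries x‖ ^ 2) * ε := by
        refine Finset.sum_le_sum fun x _ => ?_
        -- Once the amplitude is replaced by its bound independent of `b`, only the indicator for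
        -- the fixed output `A.output x` is left to average.
        refine le_trans (cubeAvg_mono (g := fun b => D * cubeAvg
          (fun b => ‖A.state b A.queries x‖ ^ 2) * if R b (A.output x) then 1 else 0)
          fun b => ?_) ?_
        · exact mul_le_mul_of_nonneg_right
            (norm_sq_le_walshDim_mul (A.state_mem_walshDegreeLE A.queries x) b)
            (by split_ifs <;> norm_num)
        · rw [cubeAvg_const_mul]
          exact mul_le_mul_of_nonneg_left (hε _) (hnonneg x)
    _ = D * ε := by
        -- States are normalised for every input, so the mean squares sum to `1` over all outcomes,
        -- whatever the workspace dimension.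
        rw [← Finset.sum_mul, ← Finset.mul_sum, ← cubeAvg_sum]
        simp only [sum_norm_sq_state, cubeAvg_const, mul_one]

/-- A query algorithm producing high-overlap strings makes at least `d / 3000` queries. -/
theorem ProducesHighOverlap.div_le_queries {d : ℕ} (hd : 250 ≤ d)
    {O : Matrix (Fin d) (Fin d) ℝ} (hO : O ∈ Matrix.orthogonalGroup (Fin d) ℝ)
    {A : QueryAlgorithm d} (hA : A.ProducesHighOverlap O) :
    (d : ℝ) / 3000 ≤ (A.queries : ℝ) := by
  classical
  by_contra! hlt
  have hd' : (250 : ℝ) ≤ d := by exact_mod_cast hd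
  have h1 : 2 / 3 ≤ cubeAvg (fun b => A.outputProb b (fun b' => HighOverlap O b b')) := by
    rw [← cubeAvg_const (n := d) (2 / 3)]
    exact cubeAvg_mono hA
  have h2 := A.cubeAvg_outputProb_le (HighOverlap O) (cubeAvg_highOverlap_le hO)
  have h3 : (1024 : ℝ) ^ A.queries ≤ Real.exp (7 * A.queries) := by
    rw [mul_comm, Real.exp_nat_mul]
    gcongr
    have h := Real.exp_one_gt_d9
    have h4 : Real.exp 7 = Real.exp 1 ^ 7 := by rw [← Real.exp_nat_mul]; norm_num
    rw [h4]
    calc (1024 : ℝ) ≤ 2.71 ^ 7 := by norm_num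
      _ ≤ _ := by gcongr; linarith
  have h5 : (1 + 1 / 1024 : ℝ) ^ d ≤ Real.exp (d * (1 / 1024)) := by
    rw [Real.exp_nat_mul]
    gcongr
    linarith [Real.add_one_le_exp (1 / 1024 : ℝ)]
  -- The exponent is below `(7/3000 + 1/1024 - 53/5000) d < -0.007 d`, which is less than `-1` for
  -- `d ≥ 250`.
  have h6 : (walshDim d A.queries : ℝ) * Real.exp (-(53 / 5000 * (d : ℝ))) ≤ Real.exp (-1) := by
    calc _ ≤ (Real.exp (7 * A.queries) * Real.exp (d * (1 / 1024))) *
          Real.exp (-(53 / 5000 * (d : ℝ))) := by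
          gcongr
          exact (walshDim_le d A.queries).trans (by gcongr)
      _ ≤ _ := by
          rw [← Real.exp_add, ← Real.exp_add]
          exact Real.exp_le_exp.2 (by linarith)
  have h7 : Real.exp (-1) < 2 / 3 := by linarith [Real.exp_neg_one_lt_d9]
  linarith

end QueryAlgorithm

theorem mainTheorem6 :
    (∀ d : ℕ, 250 ≤ d → ∀ O ∈ Matrix.orthogonalGroup (Fin d) ℝ, ∀ A : QueryAlgorithm d,
      A.ProducesHighOverlap O → (d : ℝ) / 3000 ≤ (A.queries : ℝ)) ∧
    (∃ c : ℝ, 0 < c ∧ ∀ᶠ d : ℕ in Filter.atTop,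
      ∀ O ∈ Matrix.orthogonalGroup (Fin d) ℝ, ∀ A : QueryAlgorithm d,
        A.ProducesHighOverlap O → c * (d : ℝ) ≤ (A.queries : ℝ)) := by
  refine ⟨fun d hd O hO A hA => hA.div_le_queries hd hO, 1 / 3000, by norm_num, ?_⟩
  filter_upwards [Filter.eventually_ge_atTop 250] with d hd O hO A hA
  have := hA.div_le_queries hd hO
  linarith
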